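/- For a root system $\Phi\subset\mathbb{R}^n$ let its Weyl group be the group generated by the orthogonal reflections in the hyperplanes perpendicular to the roots. Write $W(B_3)$, $W(C_3)$, $W(F_4)$ for the Weyl groups of the root systems with roots, respectively, $\pm e_i,\ \pm e_i\pm e_j$ ($1\le i\ne j\le 3$); $\pm 2e_i,\ \pm e_i\pm e_j$ ($1\le i\ne j\le 3$); and $\pm e_i,\ \pm e_i\pm e_j,\ \tfrac12(\pm e_1\pm e_2\pm e_3\pm e_4)$ ($1\le i\neq j\le 4$). Each of these root systems has exactly two root lengths; a reflection through a short (respectively long) root is called a short (respectively long) root reflection. Theorem. Let $G$ be a group with non-conjugate involutions $x,y$ and subgroups $J,K$ such that $$C_G(x)=\langle x\rangle\times J,\quad J\cong W(B_3),\qquad C_G(y)=\langle y\rangle\times K,\quad K\cong W(C_3)$$ (internal direct products). Fix isomorphisms $\varphi:J\to W(B_3)$ and $\psi:K\to W(C_3)$, and call an element of $J$ (respectively $K$) a short or long root reflection in $J$ (respectively $K$) if its image under $\varphi$ (respectively $\psi$) is one. Assume that - $x$ is a short root reflection in $K$, and $y$ is a long root reflection in $J$; - $J\cap K$ contains involutions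 $x_1,y_1$ such that $x_1$ is a short root reflection in $K$ as well as in $J$, and $y_1$ is a long root reflection in $K$ as well as in $J$; - there are a long root reflection $y_0\neq y,y_1$ in $J$ and a short root reflection $x_0\neq x,x_1$ in $K$ such that $x_0$ and $y_0$ commute. If $G=\langle J,K\rangle$, then $G\cong W(F_4)$. -/

import Mathlib

noncomputable section

namespace WeylRecognition

/-- The vector `a e_i` of Euclidean `n`-space. -/
abbrev e {n : ℕ} (i : Fin n) (a : ℝ) : EuclideanSpace ℝ (Fin n) := EuclideanSpace.single i a

/-- The root system of type `B_n`: the roots `± e_i` and `± e_i ± e_j` with `i ≠ j`. -/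
def rootsB (n : ℕ) : Set (EuclideanSpace ℝ (Fin n)) :=
  {α | (∃ i : Fin n, ∃ ε : ℝ, (ε = 1 ∨ ε = -1) ∧ α = e i ε) ∨
    (∃ i j : Fin n, i ≠ j ∧ ∃ ε δ : ℝ, (ε = 1 ∨ ε = -1) ∧ (δ = 1 ∨ δ = -1) ∧
      α = e i ε + e j δ)}

/-- The root system of type `C_n`: the roots `± 2 e_i` and `± e_i ± e_j` with `i ≠ j`. -/
def rootsC (n : ℕ) : Set (EuclideanSpace ℝ (Fin n)) :=
  {α | (∃ i : Fin n, ∃ ε : ℝ, (ε = 1 ∨ ε = -1) ∧ α = e i (2 * ε)) ∨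
    (∃ i j : Fin n, i ≠ j ∧ ∃ ε δ : ℝ, (ε = 1 ∨ ε = -1) ∧ (δ = 1 ∨ δ = -1) ∧
      α = e i ε + e j δ)}

/-- The root system of type `F_4`: the roots `± e_i`, `± e_i ± e_j` with `i ≠ j`, and
`(± e_1 ± e_2 ± e_3 ± e_4) / 2`. -/
def rootsF4 : Set (EuclideanSpace ℝ (Fin 4)) :=
  rootsB 4 ∪ {α | ∀ i : Fin 4, α i = 1 / 2 ∨ α i = -(1 / 2)}

/-- The orthogonal reflection in the hyperplane perpendicular to `α`. -/
def rootReflection {n : ℕ} (α : EuclideanSpace ℝ (Fin n)) :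
    EuclideanSpace ℝ (Fin n) ≃ₗᵢ[ℝ] EuclideanSpace ℝ (Fin n) :=
  (Submodule.span ℝ {α})ᗮ.reflection

/-- The Weyl group of a root system: the group generated by the reflections through its roots. -/
def weylGroup {n : ℕ} (Φ : Set (EuclideanSpace ℝ (Fin n))) :
    Subgroup (EuclideanSpace ℝ (Fin n) ≃ₗᵢ[ℝ] EuclideanSpace ℝ (Fin n)) :=
  Subgroup.closure (rootReflection '' Φ)

/-- A root is long if no root is strictly longer. -/
def IsLongRoot {n : ℕ} (Φ : Set (EuclideanSpace ℝ (Fin n))) (α : EuclideanSpace ℝ (Fin n)) :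
    Prop :=
  α ∈ Φ ∧ ∀ β ∈ Φ, ‖β‖ ≤ ‖α‖

/-- A root is short if some root is strictly longer. -/
def IsShortRoot {n : ℕ} (Φ : Set (EuclideanSpace ℝ (Fin n))) (α : EuclideanSpace ℝ (Fin n)) :
    Prop :=
  α ∈ Φ ∧ ∃ β ∈ Φ, ‖α‖ < ‖β‖

/-- Given a subgroup `H` of `G` identified by `φ` with the Weyl group of `Φ`: the element `g`
lies in `H` and corresponds to the reflection through a short root. -/
def IsShortRootReflectionIn {G : Type*} [Group G] {n : ℕ} {Φ : Set (EuclideanSpace ℝ (Fin n))}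
    {H : Subgroup G} (φ : H ≃* weylGroup Φ) (g : G) : Prop :=
  ∃ h : g ∈ H, ∃ α, IsShortRoot Φ α ∧
    (φ ⟨g, h⟩ : EuclideanSpace ℝ (Fin n) ≃ₗᵢ[ℝ] EuclideanSpace ℝ (Fin n)) = rootReflection α

/-- Given a subgroup `H` of `G` identified by `φ` with the Weyl group of `Φ`: the element `g`
lies in `H` and corresponds to the reflection through a long root. -/
def IsLongRootReflectionIn {G : Type*} [Group G] {n : ℕ} {Φ : Set (EuclideanSpace ℝ (Fin n))}
    {H : Subgroup G} (φ : H ≃* weylGroup Φ) (g : G) : Prop :=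
  ∃ h : g ∈ H, ∃ α, IsLongRoot Φ α ∧
    (φ ⟨g, h⟩ : EuclideanSpace ℝ (Fin n) ≃ₗᵢ[ℝ] EuclideanSpace ℝ (Fin n)) = rootReflection α

/-- The subgroup `C` is the internal direct product of its subgroups `A` and `B`. -/
def IsInternalDirectProduct {G : Type*} [Group G] (C A B : Subgroup G) : Prop :=
  (∀ a ∈ A, ∀ b ∈ B, a * b = b * a) ∧ A ⊓ B = ⊥ ∧ A ⊔ B = C

end WeylRecognition

end

/-! The elements `x, x₀, y₁, y₀` play the simple reflections of `F₄`, with the double bond between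
`x₀` and `y₁`. Inside `K` the triple `x, x₀, y₁` is simple for `C₃`, and inside `J` the triple `y₀,
y₁, x₁` is simple for `B₃`; `x` centralizes `J`, which contains `y₁` and `y₀`, and `x₀, y₀` commute
by assumption. Hence the Coxeter relations of type `F₄` hold (`F4Relations`), and since `x₁` lies in
`K` the four elements generate `G`.

Coset enumeration along `A₁ < B₂ < B₃ < F₄` bounds any group with such generators by `2 * 4 * 6 * 24
= 1152` (`F4Relations.card_closure_le`). It remains to see that `G` is not a proper quotient, for
which order above `576` suffices. The centralizer of `y` properly contains `K`, so has order at
least `96`. The class of `y` contains the six long reflections of `J` and a seventh element that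
does not commute with `x`, hence lies outside `J`. So `G` has order at least `7 * 96 = 672`.

No presentation of `W(F₄)` is used. In `G × W(F₄)` the paired generators again satisfy the
relations, so they generate a group of order at most `1152`; its projections onto two groups of
order above `576` are both isomorphisms (`F4Relations.nonempty_mulEquiv`). -/

noncomputable section

namespace WeylRecognition

/-! ### Coset enumeration and upper bounds for orders -/

/-- The closure of a set that permutes a list of cosets of `H` containing `H`
itself is finite, of order at most the length of the list times the order of `H`. -/
theorem card_closure_le {G : Type*} [Group G] {S : Set G} {H : Subgroup G} [Finite H]
    (l : List (G ⧸ H)) (h1 : ((1 : G) : G ⧸ H) ∈ l)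
    (hl : ∀ s ∈ S, ∀ z ∈ l, s • z ∈ l) :
    Finite (Subgroup.closure S) ∧ Nat.card (Subgroup.closure S) ≤ l.length * Nat.card H := by
  have key : ∀ g ∈ Subgroup.closure S, ∀ z ∈ l, g • z ∈ l := by
    intro g hg
    induction hg using Subgroup.closure_induction with
    | mem s hs => exact hl s hs
    | one => simp
    | mul g g' _ _ ih ih' => intro z hz; rw [mul_smul]; exact ih _ (ih' _ hz)
    | inv g _ ih =>
      intro z hz
      have hmaps : Set.MapsTo (fun z => g • z) {z | z ∈ l} {z | z ∈ l} := ih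
      -- An injective self-map of a finite set is onto, so inverses preserve the list too.
      have hsurj := Set.SurjOn.image_eq_of_mapsTo
        (((List.finite_toSet l).injOn_iff_bijOn_of_mapsTo hmaps).1
          (MulAction.injective g).injOn).surjOn hmaps
      obtain ⟨w, hw, rfl⟩ : z ∈ (fun z => g • z) '' {z | z ∈ l} := by rw [hsurj]; exact hz
      simpa using hw
  let f : Fin l.length × H → G := fun p => (l.get p.1).out * p.2
  have hsub : (Subgroup.closure S : Set G) ⊆ Set.range f := by
    intro g hg
    have hm := key g hg _ h1
    rw [MulAction.Quotient.smul_coe, smul_eq_mul, mul_one] at hm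
    obtain ⟨i, hi⟩ := List.get_of_mem hm
    have : (l.get i).out⁻¹ * g ∈ H := by
      rw [← QuotientGroup.eq, QuotientGroup.out_eq', hi]
    exact ⟨(i, ⟨_, this⟩), by simp [f]⟩
  have hfin : (Set.range f).Finite := Set.finite_range f
  refine ⟨(hfin.subset hsub).to_subtype, ?_⟩
  calc Nat.card (Subgroup.closure S) ≤ Nat.card (Set.range f) := Nat.card_mono hfin hsub
    _ ≤ Nat.card (Fin l.length × H) := Finite.card_range_le f
    _ = l.length * Nat.card H := by simp

/-- Coset enumeration in type `B₂` over a parabolic subgroup of type `A₁`. -/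
theorem exists_list_invariant_B2 {X : Type*} {b c : X → X} {q0 : X}
    (hbb : ∀ z, b (b z) = z) (hcc : ∀ z, c (c z) = z)
    (hbc : ∀ z, b (c (b (c z))) = c (b (c (b z)))) (b0 : b q0 = q0) :
    ∃ l : List X, l.length = 4 ∧ q0 ∈ l ∧
      ∀ z ∈ l, b z ∈ l ∧ c z ∈ l := by
  -- The named points may coincide: only an upper bound is wanted, so a collapsed table is harmless.
  obtain ⟨q1, hc0⟩ : ∃ z, z = c q0 := ⟨_, rfl⟩
  obtain ⟨q2, hb1⟩ : ∃ z, z = b q1 := ⟨_, rfl⟩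
  obtain ⟨q3, hc2⟩ : ∃ z, z = c q2 := ⟨_, rfl⟩
  have c1 : c q1 = q0 := by grind
  have b2 : b q2 = q1 := by grind
  have b3 : b q3 = q3 := by grind
  have c3 : c q3 = q2 := by grind
  refine ⟨[q0, q1, q2, q3], rfl, by simp, ?_⟩
  simp only [List.forall_mem_cons, List.not_mem_nil, false_imp_iff, implies_true, and_true]
  simp only [b0, ← hc0, ← hb1, c1, b2, ← hc2, b3, c3, List.mem_cons, true_or, or_true, and_true]

/-- Coset enumeration in type `B₃` over a parabolic subgroup of type `B₂`. -/
theorem exists_list_invariant_B3 {X : Type*} {a b c : X → X} {q0 : X}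
    (haa : ∀ z, a (a z) = z) (hbb : ∀ z, b (b z) = z) (hcc : ∀ z, c (c z) = z)
    (hab : ∀ z, a (b (a z)) = b (a (b z))) (hbc : ∀ z, b (c (b (c z))) = c (b (c (b z))))
    (hac : ∀ z, a (c z) = c (a z)) (b0 : b q0 = q0) (c0 : c q0 = q0) :
    ∃ l : List X, l.length = 6 ∧ q0 ∈ l ∧
      ∀ z ∈ l, a z ∈ l ∧ b z ∈ l ∧ c z ∈ l := by
  obtain ⟨q1, ha0⟩ : ∃ z, z = a q0 := ⟨_, rfl⟩
  obtain ⟨q2, hb1⟩ : ∃ z, z = b q1 := ⟨_, rfl⟩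
  obtain ⟨q3, hc2⟩ : ∃ z, z = c q2 := ⟨_, rfl⟩
  obtain ⟨q4, hb3⟩ : ∃ z, z = b q3 := ⟨_, rfl⟩
  obtain ⟨q5, ha4⟩ : ∃ z, z = a q4 := ⟨_, rfl⟩
  have a1 : a q1 = q0 := by grind
  have c1 : c q1 = q1 := by grind
  have a2 : a q2 = q2 := by grind
  have b2 : b q2 = q1 := by grind
  have a3 : a q3 = q3 := by grind
  have c3 : c q3 = q2 := by grind
  have b4 : b q4 = q3 := by grind
  have c4 : c q4 = q4 := by grind
  have a5 : a q5 = q4 := by grind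
  have b5 : b q5 = q5 := by grind
  have c5 : c q5 = q5 := by grind
  refine ⟨[q0, q1, q2, q3, q4, q5], rfl, by simp, ?_⟩
  simp only [List.forall_mem_cons, List.not_mem_nil, false_imp_iff, implies_true, and_true]
  simp only [← ha0, b0, c0, a1, ← hb1, c1, a2, b2, ← hc2, a3, ← hb3, c3, ← ha4, b4, c4, a5, b5,
  c5, List.mem_cons, true_or, or_true, and_true]

/-- Coset enumeration in type `F₄` over a parabolic subgroup of type `B₃`. -/
theorem exists_list_invariant_F4 {X : Type*} {a b c d : X → X} {q0 : X}
    (haa : ∀ z, a (a z) = z) (hbb : ∀ z, b (b z) = z) (hcc : ∀ z, c (c z) = z)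
    (hdd : ∀ z, d (d z) = z) (hab : ∀ z, a (b (a z)) = b (a (b z)))
    (hbc : ∀ z, b (c (b (c z))) = c (b (c (b z)))) (hcd : ∀ z, c (d (c z)) = d (c (d z)))
    (hac : ∀ z, a (c z) = c (a z)) (had : ∀ z, a (d z) = d (a z)) (hbd : ∀ z, b (d z) = d (b z))
    (a0 : a q0 = q0) (b0 : b q0 = q0) (c0 : c q0 = q0) :
    ∃ l : List X, l.length = 24 ∧ q0 ∈ l ∧
      ∀ z ∈ l, a z ∈ l ∧ b z ∈ l ∧ c z ∈ l ∧ d z ∈ l := by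
  -- A spanning tree of the coset graph; the resulting words are those of `wordsF4`.
  obtain ⟨q1, hd0⟩ : ∃ z, z = d q0 := ⟨_, rfl⟩
  obtain ⟨q2, hc1⟩ : ∃ z, z = c q1 := ⟨_, rfl⟩
  obtain ⟨q3, hb2⟩ : ∃ z, z = b q2 := ⟨_, rfl⟩
  obtain ⟨q4, hc3⟩ : ∃ z, z = c q3 := ⟨_, rfl⟩
  obtain ⟨q5, ha3⟩ : ∃ z, z = a q3 := ⟨_, rfl⟩
  obtain ⟨q6, hd4⟩ : ∃ z, z = d q4 := ⟨_, rfl⟩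
  obtain ⟨q7, ha4⟩ : ∃ z, z = a q4 := ⟨_, rfl⟩
  obtain ⟨q8, ha6⟩ : ∃ z, z = a q6 := ⟨_, rfl⟩
  obtain ⟨q9, hb7⟩ : ∃ z, z = b q7 := ⟨_, rfl⟩
  obtain ⟨q10, hb8⟩ : ∃ z, z = b q8 := ⟨_, rfl⟩
  obtain ⟨q11, hc9⟩ : ∃ z, z = c q9 := ⟨_, rfl⟩
  obtain ⟨q12, hc10⟩ : ∃ z, z = c q10 := ⟨_, rfl⟩
  obtain ⟨q13, hd11⟩ : ∃ z, z = d q11 := ⟨_, rfl⟩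
  obtain ⟨q14, hd12⟩ : ∃ z, z = d q12 := ⟨_, rfl⟩
  obtain ⟨q15, hb12⟩ : ∃ z, z = b q12 := ⟨_, rfl⟩
  obtain ⟨q16, hb14⟩ : ∃ z, z = b q14 := ⟨_, rfl⟩
  obtain ⟨q17, ha15⟩ : ∃ z, z = a q15 := ⟨_, rfl⟩
  obtain ⟨q18, hc16⟩ : ∃ z, z = c q16 := ⟨_, rfl⟩
  obtain ⟨q19, ha16⟩ : ∃ z, z = a q16 := ⟨_, rfl⟩
  obtain ⟨q20, ha18⟩ : ∃ z, z = a q18 := ⟨_, rfl⟩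
  obtain ⟨q21, hb20⟩ : ∃ z, z = b q20 := ⟨_, rfl⟩
  obtain ⟨q22, hc21⟩ : ∃ z, z = c q21 := ⟨_, rfl⟩
  obtain ⟨q23, hd22⟩ : ∃ z, z = d q22 := ⟨_, rfl⟩
  -- The other table entries, ordered so that each follows from the relations and earlier entries.
  have a1 : a q1 = q1 := by grind
  have b1 : b q1 = q1 := by grind
  have d1 : d q1 = q0 := by grind
  have a2 : a q2 = q2 := by grind
  have c2 : c q2 = q1 := by grind
  have d2 : d q2 = q2 := by grind
  have b3 : b q3 = q2 := by grind
  have d3 : d q3 = q3 := by grind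
  have b4 : b q4 = q4 := by grind
  have c4 : c q4 = q3 := by grind
  have a5 : a q5 = q3 := by grind
  have b5 : b q5 = q5 := by grind
  have c5 : c q5 = q7 := by grind
  have d5 : d q5 = q5 := by grind
  have b6 : b q6 = q6 := by grind
  have c6 : c q6 = q6 := by grind
  have d6 : d q6 = q4 := by grind
  have a7 : a q7 = q4 := by grind
  have c7 : c q7 = q5 := by grind
  have d7 : d q7 = q8 := by grind
  have a8 : a q8 = q6 := by grind
  have c8 : c q8 = q8 := by grind
  have d8 : d q8 = q7 := by grind
  have a9 : a q9 = q9 := by grind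
  have b9 : b q9 = q7 := by grind
  have d9 : d q9 = q10 := by grind
  have a10 : a q10 = q10 := by grind
  have b10 : b q10 = q8 := by grind
  have d10 : d q10 = q9 := by grind
  have a11 : a q11 = q11 := by grind
  have b11 : b q11 = q11 := by grind
  have c11 : c q11 = q9 := by grind
  have a12 : a q12 = q12 := by grind
  have c12 : c q12 = q10 := by grind
  have a13 : a q13 = q13 := by grind
  have b13 : b q13 = q13 := by grind
  have c13 : c q13 = q14 := by grind
  have d13 : d q13 = q11 := by grind
  have a14 : a q14 = q14 := by grind
  have c14 : c q14 = q13 := by grind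
  have d14 : d q14 = q12 := by grind
  have b15 : b q15 = q12 := by grind
  have c15 : c q15 = q15 := by grind
  have d15 : d q15 = q16 := by grind
  have b16 : b q16 = q14 := by grind
  have d16 : d q16 = q15 := by grind
  have a17 : a q17 = q15 := by grind
  have b17 : b q17 = q17 := by grind
  have c17 : c q17 = q17 := by grind
  have d17 : d q17 = q19 := by grind
  have b18 : b q18 = q18 := by grind
  have c18 : c q18 = q16 := by grind
  have d18 : d q18 = q18 := by grind
  have a19 : a q19 = q16 := by grind
  have b19 : b q19 = q19 := by grind
  have c19 : c q19 = q20 := by grind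
  have d19 : d q19 = q17 := by grind
  have a20 : a q20 = q18 := by grind
  have c20 : c q20 = q19 := by grind
  have d20 : d q20 = q20 := by grind
  have a21 : a q21 = q21 := by grind
  have b21 : b q21 = q20 := by grind
  have d21 : d q21 = q21 := by grind
  have a22 : a q22 = q22 := by grind
  have b22 : b q22 = q22 := by grind
  have c22 : c q22 = q21 := by grind
  have a23 : a q23 = q23 := by grind
  have b23 : b q23 = q23 := by grind
  have c23 : c q23 = q23 := by grind
  have d23 : d q23 = q22 := by grind
  refine ⟨[q0, q1, q2, q3, q4, q5, q6, q7, q8, q9, q10, q11, q12, q13, q14, q15, q16, q17, q18,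
  q19, q20, q21, q22, q23], rfl, by simp, ?_⟩
  simp only [List.forall_mem_cons, List.not_mem_nil, false_imp_iff, implies_true, and_true]
  simp only [a0, b0, c0, ← hd0, a1, b1, ← hc1, d1, a2, ← hb2, c2, d2, ← ha3, b3, ← hc3, d3,
  ← ha4, b4, c4, ← hd4, a5, b5, c5, d5, ← ha6, b6, c6, d6, a7, ← hb7, c7, d7, a8, ← hb8, c8, d8,
  a9, b9, ← hc9, d9, a10, b10, ← hc10, d10, a11, b11, c11, ← hd11, a12, ← hb12, c12, ← hd12, a13,
  b13, c13, d13, a14, ← hb14, c14, d14, ← ha15, b15, c15, d15, ← ha16, b16, ← hc16, d16, a17,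
  b17, c17, d17, ← ha18, b18, c18, d18, a19, b19, c19, d19, a20, ← hb20, c20, d20, a21, b21,
  ← hc21, d21, a22, b22, c22, ← hd22, a23, b23, c23, d23, List.mem_cons, true_or, or_true,
  and_true]

/-- The Coxeter relations of type `F₄`, with the double bond between `b` and `c`. -/
structure F4Relations {G : Type*} [Group G] (a b c d : G) : Prop where
  aa : a * a = 1
  bb : b * b = 1
  cc : c * c = 1
  dd : d * d = 1
  ab : a * b * a = b * a * b
  bc : b * c * b * c = c * b * c * b
  cd : c * d * c = d * c * d
  ac : a * c = c * a
  ad : a * d = d * a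
  bd : b * d = d * b

theorem F4Relations.subtype {G : Type*} [Group G] {H : Subgroup G} {a b c d : H}
    (h : F4Relations (a : G) b c d) : F4Relations a b c d :=
  ⟨Subtype.ext h.aa, Subtype.ext h.bb, Subtype.ext h.cc, Subtype.ext h.dd, Subtype.ext h.ab,
    Subtype.ext h.bc, Subtype.ext h.cd, Subtype.ext h.ac, Subtype.ext h.ad, Subtype.ext h.bd⟩

/-- A group generated by elements subject to the Coxeter relations of type `F₄` has order at
most `1152`. -/
theorem F4Relations.card_closure_le {G : Type*} [Group G] {a b c d : G}
    (h : F4Relations a b c d) :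
    Finite (Subgroup.closure {a, b, c, d}) ∧
      Nat.card (Subgroup.closure {a, b, c, d}) ≤ 1152 := by
  obtain ⟨aa, bb, cc, dd, ab, bc, cd, ac, ad, bd⟩ := h
  have base : ∀ (H : Subgroup G) (s : G), s ∈ H → s • ((1 : G) : G ⧸ H) = (1 : G) := by
    intro H s hs
    rw [MulAction.Quotient.smul_coe, QuotientGroup.eq]
    simpa using hs
  have A1 : Finite (Subgroup.closure {b}) ∧ Nat.card (Subgroup.closure {b}) ≤ 2 := by
    have := WeylRecognition.card_closure_le (S := {b}) (H := ⊥)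
      [((1 : G) : G ⧸ (⊥ : Subgroup G)), ((b : G) : G ⧸ (⊥ : Subgroup G))] (by simp)
      (by
        simp only [Set.mem_singleton_iff, forall_eq, List.forall_mem_cons,
          MulAction.Quotient.smul_coe, smul_eq_mul, mul_one, bb]
        simp)
    simpa using this
  obtain ⟨_, A1⟩ := A1
  have B2 : Finite (Subgroup.closure {b, c}) ∧ Nat.card (Subgroup.closure {b, c}) ≤ 8 := by
    obtain ⟨l, hl, h1, hcl⟩ := exists_list_invariant_B2 (X := G ⧸ Subgroup.closure {b})
      (b := (b • ·)) (c := (c • ·)) (q0 := ((1 : G) : G ⧸ _))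
      (by simp [smul_smul, bb]) (by simp [smul_smul, cc])
      (by simp only [smul_smul, ← mul_assoc, bc, implies_true])
      (base _ _ (Subgroup.subset_closure (by simp)))
    have := WeylRecognition.card_closure_le (S := {b, c}) l h1
      (by simpa [forall_and] using hcl)
    exact ⟨this.1, this.2.trans (by rw [hl]; omega)⟩
  obtain ⟨_, B2⟩ := B2
  have B3 : Finite (Subgroup.closure {a, b, c}) ∧
      Nat.card (Subgroup.closure {a, b, c}) ≤ 48 := by
    obtain ⟨l, hl, h1, hcl⟩ := exists_list_invariant_B3 (X := G ⧸ Subgroup.closure {b, c})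
      (a := (a • ·)) (b := (b • ·)) (c := (c • ·)) (q0 := ((1 : G) : G ⧸ _))
      (by simp [smul_smul, aa]) (by simp [smul_smul, bb]) (by simp [smul_smul, cc])
      (by simp only [smul_smul, ← mul_assoc, ab, implies_true])
      (by simp only [smul_smul, ← mul_assoc, bc, implies_true])
      (by simp only [smul_smul, ac, implies_true])
      (base _ _ (Subgroup.subset_closure (by simp)))
      (base _ _ (Subgroup.subset_closure (by simp)))
    have := WeylRecognition.card_closure_le (S := {a, b, c}) l h1
      (by simpa [forall_and] using hcl)
    exact ⟨this.1, this.2.trans (by rw [hl]; omega)⟩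
  obtain ⟨_, B3⟩ := B3
  obtain ⟨l, hl, h1, hcl⟩ := exists_list_invariant_F4 (X := G ⧸ Subgroup.closure {a, b, c})
    (a := (a • ·)) (b := (b • ·)) (c := (c • ·)) (d := (d • ·)) (q0 := ((1 : G) : G ⧸ _))
    (by simp [smul_smul, aa]) (by simp [smul_smul, bb]) (by simp [smul_smul, cc])
    (by simp [smul_smul, dd])
    (by simp only [smul_smul, ← mul_assoc, ab, implies_true])
    (by simp only [smul_smul, ← mul_assoc, bc, implies_true])
    (by simp only [smul_smul, ← mul_assoc, cd, implies_true])
    (by simp only [smul_smul, ac, implies_true])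
    (by simp only [smul_smul, ad, implies_true])
    (by simp only [smul_smul, bd, implies_true])
    (base _ _ (Subgroup.subset_closure (by simp)))
    (base _ _ (Subgroup.subset_closure (by simp)))
    (base _ _ (Subgroup.subset_closure (by simp)))
  have := WeylRecognition.card_closure_le (S := {a, b, c, d}) l h1
    (by simpa [forall_and] using hcl)
  exact ⟨this.1, this.2.trans (by rw [hl]; omega)⟩

/-! ### Isomorphism from orders -/

theorem surjective_comp_subtype_closure {G G' : Type*} [Group G] [Group G'] {S : Set G}
    (f : G →* G') (h : Subgroup.closure (f '' S) = ⊤) :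
    Function.Surjective (f.comp (Subgroup.closure S).subtype) := by
  rw [← MonoidHom.range_eq_top, MonoidHom.range_comp, Subgroup.range_subtype,
    MonoidHom.map_closure, h]

/-- The order of the kernel times that of `G'` is at most `2 * n`, hence less than twice the order
of `G'`; so the kernel is trivial. -/
theorem bijective_of_card_lt {G G' : Type*} [Group G] [Group G'] [Finite G] {n : ℕ}
    {f : G →* G'} (hle : Nat.card G ≤ 2 * n) (hlt : n < Nat.card G')
    (hf : Function.Surjective f) : Function.Bijective f := by
  refine ⟨?_, hf⟩
  rw [← MonoidHom.ker_eq_bot_iff, ← Subgroup.card_eq_one]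
  have h1 := Subgroup.card_mul_index f.ker
  rw [Subgroup.index_ker, MonoidHom.range_eq_top.2 hf, Subgroup.card_top] at h1
  have := Nat.card_pos (α := f.ker)
  nlinarith

/-- Two groups of order more than `576` that are generated by elements subject to the Coxeter
relations of type `F₄` are isomorphic. -/
theorem F4Relations.nonempty_mulEquiv {G G' : Type*} [Group G] [Group G'] {a b c d : G}
    {a' b' c' d' : G'} (h : F4Relations a b c d) (h' : F4Relations a' b' c' d')
    (hgen : Subgroup.closure {a, b, c, d} = ⊤) (hgen' : Subgroup.closure {a', b', c', d'} = ⊤)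
    (hcard : 576 < Nat.card G) (hcard' : 576 < Nat.card G') : Nonempty (G ≃* G') := by
  -- The graph of the desired isomorphism is the subgroup generated by the pairs.
  have hp : F4Relations (a, a') (b, b') (c, c') (d, d') := by
    constructor <;> simp only [Prod.mk_mul_mk, Prod.mk_eq_one, Prod.mk.injEq]
    exacts [⟨h.aa, h'.aa⟩, ⟨h.bb, h'.bb⟩, ⟨h.cc, h'.cc⟩, ⟨h.dd, h'.dd⟩, ⟨h.ab, h'.ab⟩,
      ⟨h.bc, h'.bc⟩, ⟨h.cd, h'.cd⟩, ⟨h.ac, h'.ac⟩, ⟨h.ad, h'.ad⟩, ⟨h.bd, h'.bd⟩]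
  obtain ⟨_, hle⟩ := hp.card_closure_le
  have e : Subgroup.closure {(a, a'), (b, b'), (c, c'), (d, d')} ≃* G :=
    MulEquiv.ofBijective ((MonoidHom.fst G G').comp (Subgroup.subtype _))
      (bijective_of_card_lt hle hcard
        (surjective_comp_subtype_closure _ (by simpa [Set.image_insert_eq] using hgen)))
  have e' : Subgroup.closure {(a, a'), (b, b'), (c, c'), (d, d')} ≃* G' :=
    MulEquiv.ofBijective ((MonoidHom.snd G G').comp (Subgroup.subtype _))
      (bijective_of_card_lt hle hcard'
        (surjective_comp_subtype_closure _ (by simpa [Set.image_insert_eq] using hgen')))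
  exact ⟨e.symm.trans e'⟩

/-! ### Reflections in rational coordinates -/

/-- The real vector with given rational coordinates. -/
def vec {n : ℕ} (v : Fin n → ℚ) : EuclideanSpace ℝ (Fin n) := WithLp.toLp 2 fun i => (v i : ℝ)

/-- The reflection in the hyperplane perpendicular to `α`, in rational coordinates. -/
def reflect {n : ℕ} (α v : Fin n → ℚ) : Fin n → ℚ := v - (2 * (α ⬝ᵥ v) / (α ⬝ᵥ α)) • α

section vec

variable {n : ℕ}

theorem vec_injective : Function.Injective (vec : (Fin n → ℚ) → EuclideanSpace ℝ (Fin n)) := by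
  intro v w h
  funext i
  have := congrArg (fun x : EuclideanSpace ℝ (Fin n) => x i) h
  simpa [vec] using this

theorem inner_vec (v w : Fin n → ℚ) : inner ℝ (vec v) (vec w) = ((v ⬝ᵥ w : ℚ) : ℝ) := by
  simp [vec, PiLp.inner_apply, dotProduct, mul_comm]

theorem norm_vec_sq (v : Fin n → ℚ) : ‖vec v‖ ^ 2 = ((v ⬝ᵥ v : ℚ) : ℝ) := by
  rw [← inner_vec, real_inner_self_eq_norm_sq]

theorem norm_vec_le_iff {v w : Fin n → ℚ} : ‖vec v‖ ≤ ‖vec w‖ ↔ v ⬝ᵥ v ≤ w ⬝ᵥ w := by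
  rw [← sq_le_sq₀ (norm_nonneg _) (norm_nonneg _), norm_vec_sq, norm_vec_sq, Rat.cast_le]

theorem vec_smul (c : ℚ) (v : Fin n → ℚ) : vec (c • v) = (c : ℝ) • vec v := by
  ext i; simp [vec]

theorem e_eq_vec (i : Fin n) (c : ℚ) : e i (c : ℝ) = vec (Pi.single i c) := by
  ext j
  by_cases h : j = i
  · subst h; simp [vec]
  · simp [vec, h]

theorem vec_add (v w : Fin n → ℚ) : vec (v + w) = vec v + vec w := by
  ext i; simp [vec]

theorem rootReflection_apply (α v : EuclideanSpace ℝ (Fin n)) :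
    rootReflection α v = v - (2 * inner ℝ α v / ‖α‖ ^ 2) • α := by
  rw [rootReflection, Submodule.reflection_orthogonal_apply,
    Submodule.reflection_singleton_apply]
  simp only [RCLike.ofReal_real_eq_id, id_eq, neg_sub, two_smul]
  rw [← add_smul]
  congr 2
  ring

theorem rootReflection_vec (α v : Fin n → ℚ) :
    rootReflection (vec α) (vec v) = vec (reflect α v) := by
  rw [rootReflection_apply, inner_vec, norm_vec_sq]
  ext i
  simp [vec, reflect]

theorem rootReflection_mul_self (α : EuclideanSpace ℝ (Fin n)) :
    rootReflection α * rootReflection α = 1 := by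
  refine LinearIsometryEquiv.ext fun v => ?_
  change rootReflection α (rootReflection α v) = v
  exact Submodule.reflection_reflection (Submodule.span ℝ {α})ᗮ v

theorem rootReflection_smul (α : EuclideanSpace ℝ (Fin n)) {c : ℝ} (hc : c ≠ 0) :
    rootReflection (c • α) = rootReflection α := by
  have h : Submodule.span ℝ {c • α} = Submodule.span ℝ {α} :=
    Submodule.span_singleton_smul_eq hc.isUnit α
  simp only [rootReflection, h]

theorem rootReflection_map (g : EuclideanSpace ℝ (Fin n) ≃ₗᵢ[ℝ] EuclideanSpace ℝ (Fin n))
    (α : EuclideanSpace ℝ (Fin n)) :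
    rootReflection (g α) = g * rootReflection α * g⁻¹ := by
  refine LinearIsometryEquiv.ext fun v => ?_
  change rootReflection (g α) v = g (rootReflection α (g.symm v))
  have : inner ℝ (g α) v = inner ℝ α (g.symm v) := by
    rw [← g.inner_map_map α, g.apply_symm_apply]
  rw [rootReflection_apply, rootReflection_apply, this, map_sub, map_smul, g.norm_map,
    g.apply_symm_apply]

theorem rootReflection_vec_reflect (α β : Fin n → ℚ) :
    rootReflection (vec (reflect α β)) =
      rootReflection (vec α) * rootReflection (vec β) * rootReflection (vec α) := by
  rw [← rootReflection_vec, rootReflection_map,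
    inv_eq_of_mul_eq_one_right (rootReflection_mul_self _)]

theorem rootReflection_vec_smul {c : ℚ} (hc : c ≠ 0) (v : Fin n → ℚ) :
    rootReflection (vec (c • v)) = rootReflection (vec v) := by
  rw [vec_smul, rootReflection_smul _ (by exact_mod_cast hc)]

theorem rootReflection_vec_of_eq_or_eq_neg {v w : Fin n → ℚ} (h : v = w ∨ v = -w) :
    rootReflection (vec v) = rootReflection (vec w) := by
  rcases h with rfl | rfl
  · rfl
  · rw [← neg_one_smul ℚ w, rootReflection_vec_smul (by norm_num)]

/-- Evaluating both reflections at `v` gives a decidable rational test that separates them. -/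
theorem reflect_eq_of_rootReflection_vec_eq {v w : Fin n → ℚ}
    (h : rootReflection (vec v) = rootReflection (vec w)) : reflect w v = reflect v v := by
  apply vec_injective
  rw [← rootReflection_vec, ← rootReflection_vec, h]

/-- The image of a rational vector under a product of reflections. -/
def actWord (w : List (Fin n → ℚ)) (v : Fin n → ℚ) : Fin n → ℚ := w.foldr reflect v

theorem prod_rootReflection_vec (w : List (Fin n → ℚ)) (v : Fin n → ℚ) :
    (w.map fun α => rootReflection (vec α)).prod (vec v) = vec (actWord w v) := by
  induction w with
  | nil => rfl
  | cons α w ih =>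
    rw [List.map_cons, List.prod_cons]
    change rootReflection (vec α) ((w.map fun α => rootReflection (vec α)).prod (vec v)) = _
    rw [ih, rootReflection_vec]
    rfl

/-- If the words `l` in reflections of `W` move `v` to pairwise distinct vectors, and the
subgroup `H` of `W` fixes `v`, then `W` has order at least the length of `l` times that
of `H`. -/
theorem length_mul_card_le
    {W H : Subgroup (EuclideanSpace ℝ (Fin n) ≃ₗᵢ[ℝ] EuclideanSpace ℝ (Fin n))}
    [Finite W] (hHW : H ≤ W) {v : Fin n → ℚ} (hv : ∀ h ∈ H, h (vec v) = vec v)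
    (l : List (List (Fin n → ℚ))) (hl : ∀ w ∈ l, ∀ α ∈ w, rootReflection (vec α) ∈ W)
    (hnd : (l.map fun w => actWord w v).Nodup) :
    l.length * Nat.card H ≤ Nat.card W := by
  let g : Fin l.length → W := fun i => ⟨((l.get i).map fun α => rootReflection (vec α)).prod,
    Subgroup.list_prod_mem _ (by simpa using hl _ (l.get_mem i))⟩
  let f : Fin l.length × H → W := fun p => g p.1 * ⟨p.2, hHW p.2.2⟩
  have hg : ∀ i, (g i).1 (vec v) = vec (actWord (l.get i) v) := fun i => prod_rootReflection_vec _ _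
  have hf : Function.Injective f := by
    rintro ⟨i, h⟩ ⟨j, k⟩ hij
    -- The image of `v` forgets the factor from `H` and so reveals the word.
    have h1 := congrArg (fun x : W => x.1 (vec v)) hij
    change (g i).1 (h.1 (vec v)) = (g j).1 (k.1 (vec v)) at h1
    rw [hv _ h.2, hv _ k.2, hg, hg] at h1
    have h2 := vec_injective h1
    have hinj := List.nodup_iff_injective_get.1 hnd
    have h3 : i = j := by
      have := @hinj (i.cast (by simp)) (j.cast (by simp)) (by simpa using h2)
      simpa [Fin.ext_iff] using this
    subst h3
    have h4 : (⟨h, hHW h.2⟩ : W) = ⟨k, hHW k.2⟩ := mul_left_cancel hij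
    exact Prod.ext rfl (Subtype.ext (Subtype.mk.inj h4))
  have := Nat.card_le_card_of_injective f hf
  simpa using this

end vec

/-! ### The nine reflections shared by `B₃` and `C₃` -/

/-- The roots of `B₃` up to sign, the six long ones first. -/
def rootB3 : Fin 9 → Fin 3 → ℚ :=
  ![![1, -1, 0], ![1, 1, 0], ![0, 1, -1], ![0, 1, 1], ![1, 0, -1], ![1, 0, 1],
    ![1, 0, 0], ![0, 1, 0], ![0, 0, 1]]

/-- The action of the reflections of `B₃` on themselves by conjugation. -/
def conjB3 : Fin 9 → Fin 9 → Fin 9 :=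
  ![![0, 1, 4, 5, 2, 3, 7, 6, 8],
    ![0, 1, 5, 4, 3, 2, 7, 6, 8],
    ![4, 5, 2, 3, 0, 1, 6, 8, 7],
    ![5, 4, 2, 3, 1, 0, 6, 8, 7],
    ![2, 3, 0, 1, 4, 5, 8, 7, 6],
    ![3, 2, 1, 0, 4, 5, 8, 7, 6],
    ![1, 0, 2, 3, 5, 4, 6, 7, 8],
    ![1, 0, 3, 2, 4, 5, 6, 7, 8],
    ![0, 1, 3, 2, 5, 4, 6, 7, 8]]

/-- The reflections of `B₃`. -/
def reflB3 (i : Fin 9) : EuclideanSpace ℝ (Fin 3) ≃ₗᵢ[ℝ] EuclideanSpace ℝ (Fin 3) :=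
  rootReflection (vec (rootB3 i))

/-- Roots are tabulated up to sign, which a reflection does not see, so a finite check of images up
to sign suffices. -/
theorem reflB3_conj (i j : Fin 9) : reflB3 (conjB3 i j) = reflB3 i * reflB3 j * reflB3 i := by
  rw [reflB3, reflB3, reflB3, ← rootReflection_vec_reflect]
  apply rootReflection_vec_of_eq_or_eq_neg
  revert i j
  decide +kernel

theorem reflB3_injective : Function.Injective reflB3 := by
  intro i j h
  have h1 := reflect_eq_of_rootReflection_vec_eq h
  revert i j
  have : ∀ i j, reflect (rootB3 j) (rootB3 i) = reflect (rootB3 i) (rootB3 i) → i = j := by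
    decide +kernel
  exact fun i j _ => this i j

theorem exists_rootB3_single : ∀ i : Fin 3, ∀ ε : ℚ, (ε = 1 ∨ ε = -1) →
    ∃ k : Fin 9, ∃ c : ℚ, c ^ 2 = 1 ∧ 6 ≤ k ∧ Pi.single i ε = c • rootB3 k := by
  have : ∀ i : Fin 3, ∀ ε ∈ [(1 : ℚ), -1], ∃ k : Fin 9, ∃ c ∈ [(1 : ℚ), -1],
      c ^ 2 = 1 ∧ 6 ≤ k ∧ Pi.single i ε = c • rootB3 k := by decide +kernel
  intro i ε hε
  obtain ⟨k, c, -, h⟩ := this i ε (by simpa using hε)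
  exact ⟨k, c, h⟩

theorem exists_rootB3_add : ∀ i j : Fin 3, i ≠ j → ∀ ε δ : ℚ, (ε = 1 ∨ ε = -1) →
    (δ = 1 ∨ δ = -1) → ∃ k : Fin 9, ∃ c : ℚ, c ^ 2 = 1 ∧ k < 6 ∧
      Pi.single i ε + Pi.single j δ = c • rootB3 k := by
  have : ∀ i j : Fin 3, i ≠ j → ∀ ε ∈ [(1 : ℚ), -1], ∀ δ ∈ [(1 : ℚ), -1], ∃ k : Fin 9,
      ∃ c ∈ [(1 : ℚ), -1], c ^ 2 = 1 ∧ k < 6 ∧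
      Pi.single i ε + Pi.single j δ = c • rootB3 k := by decide +kernel
  intro i j hij ε δ hε hδ
  obtain ⟨k, c, -, h⟩ := this i j hij ε (by simpa using hε) δ (by simpa using hδ)
  exact ⟨k, c, h⟩

theorem exists_rat_sign {ε : ℝ} (h : ε = 1 ∨ ε = -1) : ∃ q : ℚ, (q = 1 ∨ q = -1) ∧ ε = q := by
  rcases h with rfl | rfl
  · exact ⟨1, by simp, by simp⟩
  · exact ⟨-1, by simp, by simp⟩

theorem exists_of_mem_rootsB {α : EuclideanSpace ℝ (Fin 3)} (h : α ∈ rootsB 3) :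
    ∃ k : Fin 9, ∃ c : ℚ, c ^ 2 = 1 ∧ α = vec (c • rootB3 k) := by
  rcases h with ⟨i, ε, hε, rfl⟩ | ⟨i, j, hij, ε, δ, hε, hδ, rfl⟩
  · obtain ⟨q, hq, rfl⟩ := exists_rat_sign hε
    obtain ⟨k, c, hc, -, h⟩ := exists_rootB3_single i q hq
    exact ⟨k, c, hc, by rw [e_eq_vec, h]⟩
  · obtain ⟨q, hq, rfl⟩ := exists_rat_sign hε
    obtain ⟨q', hq', rfl⟩ := exists_rat_sign hδ
    obtain ⟨k, c, hc, -, h⟩ := exists_rootB3_add i j hij q q' hq hq'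
    exact ⟨k, c, hc, by rw [e_eq_vec, e_eq_vec, ← vec_add, h]⟩

/-- Doubling the coordinate roots of `B₃` gives `C₃`; the factor `c` records this, so that lengths
in `C₃` can be read off the `B₃` table. -/
theorem exists_of_mem_rootsC {α : EuclideanSpace ℝ (Fin 3)} (h : α ∈ rootsC 3) :
    ∃ k : Fin 9, ∃ c : ℚ, c ^ 2 = (if k < 6 then 1 else 4) ∧ α = vec (c • rootB3 k) := by
  rcases h with ⟨i, ε, hε, rfl⟩ | ⟨i, j, hij, ε, δ, hε, hδ, rfl⟩
  · obtain ⟨q, hq, rfl⟩ := exists_rat_sign hε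
    obtain ⟨k, c, hc, hk, h⟩ := exists_rootB3_single i q hq
    refine ⟨k, 2 * c, by rw [if_neg (not_lt.2 hk), mul_pow, hc]; norm_num, ?_⟩
    have : (2 : ℝ) * q = ((2 * q : ℚ) : ℝ) := by push_cast; rfl
    rw [this, e_eq_vec, mul_smul, ← h, ← smul_eq_mul, Pi.single_smul]
  · obtain ⟨q, hq, rfl⟩ := exists_rat_sign hε
    obtain ⟨q', hq', rfl⟩ := exists_rat_sign hδ
    obtain ⟨k, c, hc, hk, h⟩ := exists_rootB3_add i j hij q q' hq hq'
    exact ⟨k, c, by rw [if_pos hk, hc], by rw [e_eq_vec, e_eq_vec, ← vec_add, h]⟩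

theorem vec_rootB3_mem_rootsB (k : Fin 9) : vec (rootB3 k) ∈ rootsB 3 := by
  have h : (∃ i : Fin 3, rootB3 k = Pi.single i 1) ∨ ∃ i j : Fin 3, i ≠ j ∧
      ∃ q ∈ [(1 : ℚ), -1], rootB3 k = Pi.single i 1 + Pi.single j q := by
    revert k; decide +kernel
  rcases h with ⟨i, h⟩ | ⟨i, j, hij, q, hq, h⟩
  · exact Or.inl ⟨i, 1, by simp, by rw [h, ← e_eq_vec]; simp⟩
  · refine Or.inr ⟨i, j, hij, 1, q, by simp, ?_, by rw [h, vec_add, ← e_eq_vec, ← e_eq_vec]; simp⟩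
    simp only [List.mem_cons, List.not_mem_nil, or_false] at hq
    rcases hq with rfl | rfl <;> simp

theorem exists_vec_smul_rootB3_mem_rootsC (k : Fin 9) :
    ∃ c : ℚ, c = (if k < 6 then 1 else 2) ∧ vec (c • rootB3 k) ∈ rootsC 3 := by
  have h : (∃ i : Fin 3, 6 ≤ k ∧ rootB3 k = Pi.single i 1) ∨ ∃ i j : Fin 3, k < 6 ∧ i ≠ j ∧
      ∃ q ∈ [(1 : ℚ), -1], rootB3 k = Pi.single i 1 + Pi.single j q := by
    revert k; decide +kernel
  refine ⟨_, rfl, ?_⟩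
  rcases h with ⟨i, hk, h⟩ | ⟨i, j, hk, hij, q, hq, h⟩
  · refine Or.inl ⟨i, 1, by simp, ?_⟩
    rw [if_neg (not_lt.2 hk), h, ← Pi.single_smul, ← e_eq_vec]
    simp
  · refine Or.inr ⟨i, j, hij, 1, q, by simp, ?_, ?_⟩
    · simp only [List.mem_cons, List.not_mem_nil, or_false] at hq
      rcases hq with rfl | rfl <;> simp
    · rw [if_pos hk, one_smul, h, vec_add, ← e_eq_vec, ← e_eq_vec]
      simp

theorem rootB3_dotProduct_self (k : Fin 9) : rootB3 k ⬝ᵥ rootB3 k = if k < 6 then 2 else 1 := by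
  revert k; decide +kernel

theorem rootReflection_vec_smul_rootB3 {k : Fin 9} {c : ℚ} (hc : c ^ 2 ≠ 0) :
    rootReflection (vec (c • rootB3 k)) = reflB3 k :=
  rootReflection_vec_smul (by simpa using hc) _

theorem dotProduct_smul_self (c : ℚ) {n : ℕ} (v : Fin n → ℚ) :
    (c • v) ⬝ᵥ (c • v) = c ^ 2 * (v ⬝ᵥ v) := by
  simp [sq, mul_assoc]

theorem IsLongRoot.exists_reflB3 {α : EuclideanSpace ℝ (Fin 3)} (h : IsLongRoot (rootsB 3) α) :
    ∃ k < 6, rootReflection α = reflB3 k := by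
  obtain ⟨k, c, hc, rfl⟩ := exists_of_mem_rootsB h.1
  refine ⟨k, ?_, rootReflection_vec_smul_rootB3 (by simp [hc])⟩
  have := h.2 _ (vec_rootB3_mem_rootsB 0)
  rw [norm_vec_le_iff, dotProduct_smul_self, hc, rootB3_dotProduct_self,
    rootB3_dotProduct_self] at this
  by_contra hk
  rw [if_neg hk, if_pos (by decide)] at this
  norm_num at this

theorem IsShortRoot.exists_reflB3 {α : EuclideanSpace ℝ (Fin 3)}
    (h : IsShortRoot (rootsB 3) α) : ∃ k, 6 ≤ k ∧ rootReflection α = reflB3 k := by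
  obtain ⟨hα, β, hβ, hlt⟩ := h
  obtain ⟨k, c, hc, rfl⟩ := exists_of_mem_rootsB hα
  obtain ⟨k', c', hc', rfl⟩ := exists_of_mem_rootsB hβ
  refine ⟨k, ?_, rootReflection_vec_smul_rootB3 (by simp [hc])⟩
  rw [← not_le, norm_vec_le_iff, dotProduct_smul_self, dotProduct_smul_self, hc, hc',
    rootB3_dotProduct_self, rootB3_dotProduct_self] at hlt
  by_contra hk
  apply hlt
  rw [if_pos (not_le.1 hk)]
  split_ifs <;> norm_num

/-- After doubling, coordinate roots have squared length 4 against 2 for the others, so long and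
short are interchanged relative to `B₃`. -/
theorem IsLongRoot.exists_reflC3 {α : EuclideanSpace ℝ (Fin 3)} (h : IsLongRoot (rootsC 3) α) :
    ∃ k, 6 ≤ k ∧ rootReflection α = reflB3 k := by
  obtain ⟨k, c, hc, rfl⟩ := exists_of_mem_rootsC h.1
  refine ⟨k, ?_, rootReflection_vec_smul_rootB3 (by rw [hc]; split_ifs <;> norm_num)⟩
  obtain ⟨c', hc', hmem⟩ := exists_vec_smul_rootB3_mem_rootsC 6
  have := h.2 _ hmem
  rw [norm_vec_le_iff, dotProduct_smul_self, dotProduct_smul_self, hc, hc',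
    rootB3_dotProduct_self, rootB3_dotProduct_self] at this
  by_contra hk
  norm_num [not_le.1 hk] at this

theorem IsShortRoot.exists_reflC3 {α : EuclideanSpace ℝ (Fin 3)}
    (h : IsShortRoot (rootsC 3) α) : ∃ k < 6, rootReflection α = reflB3 k := by
  obtain ⟨hα, β, hβ, hlt⟩ := h
  obtain ⟨k, c, hc, rfl⟩ := exists_of_mem_rootsC hα
  obtain ⟨k', c', hc', rfl⟩ := exists_of_mem_rootsC hβ
  refine ⟨k, ?_, rootReflection_vec_smul_rootB3 (by rw [hc]; split_ifs <;> norm_num)⟩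
  rw [← not_le, norm_vec_le_iff, dotProduct_smul_self, dotProduct_smul_self, hc, hc',
    rootB3_dotProduct_self, rootB3_dotProduct_self] at hlt
  by_contra hk
  apply hlt
  rw [if_neg hk, if_neg hk]
  split_ifs <;> norm_num

theorem weylGroup_rootsB3 : weylGroup (rootsB 3) = Subgroup.closure (Set.range reflB3) := by
  have h : rootReflection '' rootsB 3 = Set.range reflB3 := by
    ext g
    constructor
    · rintro ⟨α, hα, rfl⟩
      obtain ⟨k, c, hc, rfl⟩ := exists_of_mem_rootsB hα
      exact ⟨k, (rootReflection_vec_smul_rootB3 (by simp [hc])).symm⟩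
    · rintro ⟨k, rfl⟩
      exact ⟨_, vec_rootB3_mem_rootsB k, rfl⟩
  rw [weylGroup, h]

theorem weylGroup_rootsC3 : weylGroup (rootsC 3) = Subgroup.closure (Set.range reflB3) := by
  have h : rootReflection '' rootsC 3 = Set.range reflB3 := by
    ext g
    constructor
    · rintro ⟨α, hα, rfl⟩
      obtain ⟨k, c, hc, rfl⟩ := exists_of_mem_rootsC hα
      exact ⟨k, (rootReflection_vec_smul_rootB3 (by rw [hc]; split_ifs <;> norm_num)).symm⟩
    · rintro ⟨k, rfl⟩
      obtain ⟨c, hc, hmem⟩ := exists_vec_smul_rootB3_mem_rootsC k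
      exact ⟨_, hmem, rootReflection_vec_smul_rootB3 (by rw [hc]; split_ifs <;> norm_num)⟩
  rw [weylGroup, h]

/-- Minimal words for the elements of a group generated by `a, b, c` subject to the Coxeter
relations of type `B₃`. -/
def wordsB3 {X : Type*} (a b c : X) : List (List X) :=
  [[], [a], [b, a], [c, b, a], [b, c, b, a], [a, b, c, b, a]].flatMap fun u =>
    [[], [c], [b, c], [c, b, c]].flatMap fun v => [u ++ v, u ++ v ++ [b]]

theorem length_wordsB3 {X : Type*} (a b c : X) : (wordsB3 a b c).length = 48 := rfl

theorem mem_of_mem_wordsB3 {X : Type*} {a b c : X} : ∀ w ∈ wordsB3 a b c, ∀ s ∈ w,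
    s = a ∨ s = b ∨ s = c := by
  simp [wordsB3]

theorem card_closure_reflB3 [Finite (Subgroup.closure (Set.range reflB3))] :
    48 ≤ Nat.card (Subgroup.closure (Set.range reflB3)) := by
  -- The vector `(3, 2, 1)` is orthogonal to no root, so the 48 words move it to distinct places.
  have := length_mul_card_le (W := Subgroup.closure (Set.range reflB3)) (H := ⊥) bot_le
    (v := ![3, 2, 1]) (by simp) (wordsB3 (rootB3 0) (rootB3 2) (rootB3 8)) (by
      intro w hw α hα
      rcases mem_of_mem_wordsB3 w hw α hα with rfl | rfl | rfl <;>
        exact Subgroup.subset_closure ⟨_, rfl⟩) (by decide +kernel)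
  simpa [length_wordsB3] using this

/-! ### The Weyl group of `F₄`: generators, relations, order -/

/-- The roots of `F₄` up to sign, the four simple ones first. -/
def rootF4 : Fin 24 → Fin 4 → ℚ :=
  ![![1/2, -1/2, -1/2, -1/2], ![0, 0, 0, 1], ![0, 0, 1, -1],
    ![0, 1, -1, 0], ![1/2, -1/2, -1/2, 1/2], ![0, 0, 1, 0],
    ![0, 0, 1, 1], ![0, 1, 0, -1], ![1/2, -1/2, 1/2, -1/2],
    ![0, 1, 0, 0], ![1, -1, 0, 0], ![0, 1, 0, 1],
    ![1/2, -1/2, 1/2, 1/2], ![1/2, 1/2, -1/2, -1/2], ![1, 0, -1, 0],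
    ![0, 1, 1, 0], ![1/2, 1/2, -1/2, 1/2], ![1, 0, 0, -1],
    ![1/2, 1/2, 1/2, -1/2], ![1, 0, 0, 1], ![1/2, 1/2, 1/2, 1/2],
    ![1, 0, 1, 0], ![1, 0, 0, 0], ![1, 1, 0, 0]]

/-- The reflections of `F₄`. -/
def reflF4 (i : Fin 24) : EuclideanSpace ℝ (Fin 4) ≃ₗᵢ[ℝ] EuclideanSpace ℝ (Fin 4) :=
  rootReflection (vec (rootF4 i))

theorem exists_reflF4_of_mem {α : EuclideanSpace ℝ (Fin 4)} (h : α ∈ rootsF4) :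
    ∃ k, rootReflection α = reflF4 k := by
  have single : ∀ i : Fin 4, ∀ ε ∈ [(1 : ℚ), -1], ∃ k : Fin 24,
      Pi.single i ε = rootF4 k ∨ Pi.single i ε = -rootF4 k := by decide +kernel
  have add : ∀ i j : Fin 4, i ≠ j → ∀ ε ∈ [(1 : ℚ), -1], ∀ δ ∈ [(1 : ℚ), -1], ∃ k : Fin 24,
      Pi.single i ε + Pi.single j δ = rootF4 k ∨
      Pi.single i ε + Pi.single j δ = -rootF4 k := by decide +kernel
  have half : ∀ s : Fin 4 → Bool, ∃ k : Fin 24,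
      (fun i => if s i then 1 / 2 else -(1 / 2)) = rootF4 k ∨
      (fun i => if s i then 1 / 2 else -(1 / 2)) = -rootF4 k := by decide +kernel
  rcases h with (⟨i, ε, hε, rfl⟩ | ⟨i, j, hij, ε, δ, hε, hδ, rfl⟩) | h
  · obtain ⟨q, hq, rfl⟩ := exists_rat_sign hε
    obtain ⟨k, h⟩ := single i q (by simpa using hq)
    exact ⟨k, by rw [e_eq_vec]; exact rootReflection_vec_of_eq_or_eq_neg h⟩
  · obtain ⟨q, hq, rfl⟩ := exists_rat_sign hε
    obtain ⟨q', hq', rfl⟩ := exists_rat_sign hδ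
    obtain ⟨k, h⟩ := add i j hij q (by simpa using hq) q' (by simpa using hq')
    exact ⟨k, by
      rw [e_eq_vec, e_eq_vec, ← vec_add]; exact rootReflection_vec_of_eq_or_eq_neg h⟩
  · obtain ⟨k, hk⟩ := half fun i => decide (α i = 1 / 2)
    refine ⟨k, ?_⟩
    rw [reflF4, ← rootReflection_vec_of_eq_or_eq_neg hk]
    congr 1
    ext i
    have hne : ¬ (-2⁻¹ : ℝ) = 2⁻¹ := by norm_num
    rcases h i with h | h <;> simp [vec, h, hne]

theorem reflF4_simple_mem {k : Fin 24} (hk : k < 4) : reflF4 k ∈ weylGroup rootsF4 := by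
  refine Subgroup.subset_closure ⟨_, ?_, rfl⟩
  have h : (∃ i : Fin 4, rootF4 k = Pi.single i 1) ∨ (∃ i j : Fin 4, i ≠ j ∧
      rootF4 k = Pi.single i 1 + Pi.single j (-1)) ∨
      ∀ i, rootF4 k i = 1 / 2 ∨ rootF4 k i = -(1 / 2) := by
    revert k; decide +kernel
  rcases h with ⟨i, h⟩ | ⟨i, j, hij, h⟩ | h
  · exact Or.inl (Or.inl ⟨i, 1, by simp, by rw [h, ← e_eq_vec]; simp⟩)
  · exact Or.inl (Or.inr ⟨i, j, hij, 1, -1, by simp, by simp,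
      by rw [h, vec_add, ← e_eq_vec, ← e_eq_vec]; simp⟩)
  · refine Or.inr fun i => ?_
    rcases h i with h | h <;> simp [vec, h]

theorem closure_reflF4 :
    Subgroup.closure {reflF4 0, reflF4 1, reflF4 2, reflF4 3} = weylGroup rootsF4 := by
  apply le_antisymm
  · rw [Subgroup.closure_le]
    rintro _ (rfl | rfl | rfl | rfl) <;> exact reflF4_simple_mem (by decide)
  · have simple : ∀ k : Fin 24, k < 4 →
        reflF4 k ∈ Subgroup.closure {reflF4 0, reflF4 1, reflF4 2, reflF4 3} := by
      intro k hk
      apply Subgroup.subset_closure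
      have : k = 0 ∨ k = 1 ∨ k = 2 ∨ k = 3 := by revert k; decide
      rcases this with rfl | rfl | rfl | rfl <;> simp
    have all : ∀ n : ℕ, ∀ k : Fin 24, k.val = n →
        reflF4 k ∈ Subgroup.closure {reflF4 0, reflF4 1, reflF4 2, reflF4 3} := by
      intro n
      induction n using Nat.strong_induction_on with
      | _ n ih =>
        rintro k rfl
        by_cases hk : k < 4
        · exact simple k hk
        -- The roots are listed so that each non-simple one is, up to sign, a simple reflection of
        -- an earlier one.
        · have h : ∀ k : Fin 24, ¬ k < 4 → ∃ s < (4 : Fin 24), ∃ j < k,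
              rootF4 k = reflect (rootF4 s) (rootF4 j) ∨
              rootF4 k = -reflect (rootF4 s) (rootF4 j) := by decide +kernel
          obtain ⟨s, hs, j, hj, h⟩ := h k hk
          have hk : reflF4 k = reflF4 s * reflF4 j * reflF4 s := by
            rw [reflF4, rootReflection_vec_of_eq_or_eq_neg h, rootReflection_vec_reflect]
            rfl
          rw [hk]
          exact mul_mem (mul_mem (simple s hs) (ih j hj j rfl)) (simple s hs)
    refine (Subgroup.closure_le _).2 ?_
    rintro _ ⟨α, hα, rfl⟩
    obtain ⟨k, hk⟩ := exists_reflF4_of_mem hα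
    rw [hk]
    exact all k k rfl

theorem f4Relations_reflF4 : F4Relations (reflF4 0) (reflF4 1) (reflF4 2) (reflF4 3) := by
  have sq : ∀ k, reflF4 k * reflF4 k = 1 := fun k => rootReflection_mul_self _
  have comm : ∀ i j, (reflect (rootF4 i) (rootF4 j) = rootF4 j) →
      reflF4 i * reflF4 j = reflF4 j * reflF4 i := by
    intro i j h
    have := rootReflection_vec_reflect (rootF4 i) (rootF4 j)
    rw [h] at this
    change reflF4 j = reflF4 i * reflF4 j * reflF4 i at this
    nth_rw 2 [this]
    rw [mul_assoc, sq, mul_one]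
  have braid : ∀ i j, (reflect (rootF4 i) (rootF4 j) = reflect (rootF4 j) (rootF4 i)) →
      reflF4 i * reflF4 j * reflF4 i = reflF4 j * reflF4 i * reflF4 j := by
    intro i j h
    rw [reflF4, reflF4, ← rootReflection_vec_reflect, h, rootReflection_vec_reflect]
  refine ⟨sq _, sq _, sq _, sq _, braid _ _ (by decide +kernel), ?_, braid _ _ (by decide +kernel),
    comm _ _ (by decide +kernel), comm _ _ (by decide +kernel), comm _ _ (by decide +kernel)⟩
  -- The roots `e₃ - e₄` and `e₃ + e₄` are orthogonal, so `c` commutes with `b * c * b`, which is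
  -- the double-bond relation.
  have h : reflect (rootF4 2) (reflect (rootF4 1) (rootF4 2)) =
      reflect (rootF4 1) (rootF4 2) := by decide +kernel
  have := rootReflection_vec_reflect (rootF4 2) (reflect (rootF4 1) (rootF4 2))
  rw [h, rootReflection_vec_reflect] at this
  change reflF4 1 * reflF4 2 * reflF4 1 =
    reflF4 2 * (reflF4 1 * reflF4 2 * reflF4 1) * reflF4 2 at this
  rw [this]
  simp only [mul_assoc, sq, mul_one]

/-- Minimal words for the cosets of a parabolic subgroup of type `B₃` in a group generated by
`a, b, c, d` subject to the Coxeter relations of type `F₄`. -/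
def wordsF4 {X : Type*} (a b c d : X) : List (List X) :=
  [[], [d], [c, d], [b, c, d], [c, b, c, d], [a, b, c, d], [d, c, b, c, d], [a, c, b, c, d],
    [a, d, c, b, c, d], [b, a, c, b, c, d], [b, a, d, c, b, c, d], [c, b, a, c, b, c, d],
    [c, b, a, d, c, b, c, d], [d, c, b, a, c, b, c, d], [d, c, b, a, d, c, b, c, d],
    [b, c, b, a, d, c, b, c, d], [b, d, c, b, a, d, c, b, c, d], [a, b, c, b, a, d, c, b, c, d],
    [c, b, d, c, b, a, d, c, b, c, d], [a, b, d, c, b, a, d, c, b, c, d],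
    [a, c, b, d, c, b, a, d, c, b, c, d], [b, a, c, b, d, c, b, a, d, c, b, c, d],
    [c, b, a, c, b, d, c, b, a, d, c, b, c, d], [d, c, b, a, c, b, d, c, b, a, d, c, b, c, d]]

theorem mem_of_mem_wordsF4 {X : Type*} {a b c d : X} : ∀ w ∈ wordsF4 a b c d, ∀ s ∈ w,
    s = a ∨ s = b ∨ s = c ∨ s = d := by
  simp [wordsF4]

/-- Orbit counting in two stages: the first three simple reflections fix the long root `e₁ + e₂`,
which has 24 images under the group, and they generate at least 48 elements, seen on the generic
vector `(8, 4, 2, 1)`. -/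
theorem card_weylGroup_rootsF4 [Finite (weylGroup rootsF4)] :
    1152 ≤ Nat.card (weylGroup rootsF4) := by
  let H : Subgroup (EuclideanSpace ℝ (Fin 4) ≃ₗᵢ[ℝ] EuclideanSpace ℝ (Fin 4)) :=
    Subgroup.closure {reflF4 0, reflF4 1, reflF4 2}
  have hle : H ≤ weylGroup rootsF4 := by
    rw [← closure_reflF4]
    apply Subgroup.closure_mono
    rintro _ (rfl | rfl | rfl) <;> simp
  have : Finite H := Finite.Set.subset _ hle
  have hH : 48 ≤ Nat.card H := by
    have := length_mul_card_le (W := H) (H := ⊥) bot_le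
      (v := ![8, 4, 2, 1]) (by simp) (wordsB3 (rootF4 0) (rootF4 1) (rootF4 2)) (by
        intro w hw α hα
        rcases mem_of_mem_wordsB3 w hw α hα with rfl | rfl | rfl <;>
          exact Subgroup.subset_closure (by simp [reflF4])) (by decide +kernel)
    simpa [length_wordsB3] using this
  have hfix : ∀ h ∈ H, h (vec ![1, 1, 0, 0]) = vec ![1, 1, 0, 0] := by
    intro h hh
    induction hh using Subgroup.closure_induction with
    | mem s hs =>
      have key : ∀ k : Fin 24, k < 3 → reflect (rootF4 k) ![1, 1, 0, 0] = ![1, 1, 0, 0] := by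
        decide +kernel
      rcases hs with rfl | rfl | rfl <;> rw [reflF4, rootReflection_vec, key _ (by decide)]
    | one => rfl
    | mul g g' _ _ ih ih' => exact (congrArg g ih').trans ih
    | inv g _ ih => exact g.symm_apply_eq.2 ih.symm
  have := length_mul_card_le hle hfix (wordsF4 (rootF4 0) (rootF4 1) (rootF4 2) (rootF4 3)) (by
    intro w hw α hα
    rcases mem_of_mem_wordsF4 w hw α hα with rfl | rfl | rfl | rfl <;>
      exact reflF4_simple_mem (by decide)) (by decide +kernel)
  have hlen : (wordsF4 (rootF4 0) (rootF4 1) (rootF4 2) (rootF4 3)).length = 24 := rfl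
  rw [hlen] at this
  omega

/-! ### Reflection frames and their combinatorics -/

/-- A family of elements of a group behaving under conjugation like the reflections of `B₃`, and
generating the subgroup `H`. -/
structure IsReflectionFrame {G : Type*} [Group G] (ρ : Fin 9 → G) (H : Subgroup G) : Prop where
  injective : Function.Injective ρ
  mul_self : ∀ i, ρ i * ρ i = 1
  conj : ∀ i j, ρ (conjB3 i j) = ρ i * ρ j * ρ i
  closure_range : Subgroup.closure (Set.range ρ) = H

/-- Pulling the reflections back along `φ` moves all questions about them into `G`; the last clause
gives the named reflections their indices. -/
theorem exists_isReflectionFrame {G : Type*} [Group G] {H : Subgroup G}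
    {W : Subgroup (EuclideanSpace ℝ (Fin 3) ≃ₗᵢ[ℝ] EuclideanSpace ℝ (Fin 3))}
    (hW : W = Subgroup.closure (Set.range reflB3)) (φ : H ≃* W) :
    ∃ ρ : Fin 9 → G, IsReflectionFrame ρ H ∧ ∀ (g : G) (h : g ∈ H) (k : Fin 9),
      (φ ⟨g, h⟩ : EuclideanSpace ℝ (Fin 3) ≃ₗᵢ[ℝ] EuclideanSpace ℝ (Fin 3)) = reflB3 k →
        g = ρ k := by
  subst hW
  let r : Fin 9 → Subgroup.closure (Set.range reflB3) := fun k =>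
    ⟨reflB3 k, Subgroup.subset_closure ⟨k, rfl⟩⟩
  let f : Subgroup.closure (Set.range reflB3) →* G := H.subtype.comp φ.symm.toMonoidHom
  have hf : Function.Injective f := H.subtype_injective.comp φ.symm.injective
  refine ⟨fun k => f (r k), ⟨?_, ?_, ?_, ?_⟩, ?_⟩
  · intro i j h
    exact reflB3_injective (Subtype.mk.inj (hf h))
  · intro i
    rw [← map_mul, ← map_one f]
    exact congrArg f (Subtype.ext (rootReflection_mul_self _))
  · intro i j
    rw [← map_mul, ← map_mul]
    exact congrArg f (Subtype.ext (reflB3_conj i j))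
  · have h1 : Subgroup.closure (Set.range r) = ⊤ := by
      rw [← Subgroup.closure_closure_coe_preimage (k := Set.range reflB3)]
      congr 1
      ext g
      simp [r, Subtype.ext_iff]
    have h2 : (fun k => f (r k)) = f ∘ r := rfl
    rw [h2, Set.range_comp, ← MonoidHom.map_closure, h1, ← MonoidHom.range_eq_map]
    ext g
    constructor
    · rintro ⟨w, rfl⟩
      exact (φ.symm w).2
    · intro hg
      exact ⟨φ ⟨g, hg⟩, by simp [f]⟩
  · intro g h k hk
    have : φ ⟨g, h⟩ = r k := Subtype.ext hk
    change g = ((φ.symm (r k) : H) : G)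
    rw [← this, φ.symm_apply_apply]

section Frame

variable {G : Type*} [Group G] {ρ : Fin 9 → G} {H : Subgroup G}

theorem IsReflectionFrame.mem (hρ : IsReflectionFrame ρ H) (i : Fin 9) : ρ i ∈ H := by
  rw [← hρ.closure_range]
  exact Subgroup.subset_closure ⟨i, rfl⟩

/-- This turns commutation in `G` into a lookup in a finite table. -/
theorem IsReflectionFrame.commute_iff (hρ : IsReflectionFrame ρ H) {i j : Fin 9} :
    Commute (ρ i) (ρ j) ↔ conjB3 i j = j := by
  rw [← hρ.injective.eq_iff, hρ.conj]
  have hi : (ρ i)⁻¹ = ρ i := inv_eq_of_mul_eq_one_right (hρ.mul_self i)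
  nth_rw 3 [← hi]
  rw [mul_inv_eq_iff_eq_mul]
  exact Iff.rfl

/-- The indices `t, t', t₀, s` label reflections of `B₃` that are, up to the choice of
coordinates, the reflections in the roots `e₁ - e₂, e₁ + e₂, e₂ - e₃, e₃`. -/
def InPosition (t t' t₀ s : Fin 9) : Prop :=
  t < 6 ∧ t' < 6 ∧ t₀ < 6 ∧ 6 ≤ s ∧ t ≠ t' ∧ t₀ ≠ t ∧ t₀ ≠ t' ∧ conjB3 t t' = t' ∧ conjB3 s t = t

instance (t t' t₀ s : Fin 9) : Decidable (InPosition t t' t₀ s) := by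
  unfold InPosition; infer_instance

theorem InPosition.symm : ∀ {t t' t₀ s : Fin 9}, InPosition t t' t₀ s → InPosition t' t t₀ s := by
  decide +kernel

theorem InPosition.braid : ∀ {t t' t₀ s : Fin 9}, InPosition t t' t₀ s →
    conjB3 t t₀ = conjB3 t₀ t := by
  decide +kernel

theorem InPosition.conj_conj : ∀ {t t' t₀ s : Fin 9}, InPosition t t' t₀ s →
    conjB3 s (conjB3 t₀ s) = conjB3 t₀ s := by
  decide +kernel

theorem InPosition.conj_conj_ne : ∀ {t t' t₀ s : Fin 9}, InPosition t t' t₀ s →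
    conjB3 t (conjB3 t₀ s) ≠ conjB3 t₀ s := by
  decide +kernel

/-- In the model coordinates: `e₁ - e₂` goes to `e₁ - e₃`, then `e₁ + e₃`, then `e₁ + e₂`. -/
theorem InPosition.conj_eq : ∀ {t t' t₀ s : Fin 9}, InPosition t t' t₀ s →
    conjB3 t₀ (conjB3 s (conjB3 t₀ t)) = t' := by
  decide +kernel

/-- These are all six long reflections, written as successive conjugates of the first. -/
theorem InPosition.nodup : ∀ {t t' t₀ s : Fin 9}, InPosition t t' t₀ s →
    [t, conjB3 t₀ t, conjB3 t (conjB3 t₀ t), conjB3 s (conjB3 t₀ t),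
      conjB3 s (conjB3 t (conjB3 t₀ t)), conjB3 t₀ (conjB3 s (conjB3 t₀ t))].Nodup := by
  decide +kernel

theorem InPosition.mem : ∀ {t t' t₀ s : Fin 9}, InPosition t t' t₀ s → ∀ k,
    k ∈ [t, t₀, s, conjB3 t t₀, conjB3 s t₀, conjB3 s (conjB3 t t₀), conjB3 t₀ s,
      conjB3 t (conjB3 t₀ s), conjB3 (conjB3 t₀ s) t] := by
  decide +kernel

theorem InPosition.closure_eq (hρ : IsReflectionFrame ρ H) {t t' t₀ s : Fin 9}
    (h : InPosition t t' t₀ s) : Subgroup.closure {ρ t, ρ t₀, ρ s} = H := by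
  rw [← hρ.closure_range]
  apply le_antisymm
  · apply Subgroup.closure_mono
    rintro _ (rfl | rfl | rfl) <;> exact ⟨_, rfl⟩
  · rw [Subgroup.closure_le]
    set C := Subgroup.closure {ρ t, ρ t₀, ρ s}
    have ht : ρ t ∈ C := Subgroup.subset_closure (by simp)
    have ht₀ : ρ t₀ ∈ C := Subgroup.subset_closure (by simp)
    have hs : ρ s ∈ C := Subgroup.subset_closure (by simp)
    have hc : ∀ i j, ρ i ∈ C → ρ j ∈ C → ρ (conjB3 i j) ∈ C := by
      intro i j hi hj
      rw [hρ.conj]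
      exact mul_mem (mul_mem hi hj) hi
    rintro _ ⟨k, rfl⟩
    have hk := h.mem k
    simp only [List.mem_cons, List.not_mem_nil, or_false] at hk
    rcases hk with rfl | rfl | rfl | rfl | rfl | rfl | rfl | rfl | rfl
    exacts [ht, ht₀, hs, hc _ _ ht ht₀, hc _ _ hs ht₀, hc _ _ hs (hc _ _ ht ht₀),
      hc _ _ ht₀ hs, hc _ _ ht (hc _ _ ht₀ hs), hc _ _ (hc _ _ ht₀ hs) ht]

theorem IsReflectionFrame.isConj (hρ : IsReflectionFrame ρ H) (i j : Fin 9) :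
    IsConj (ρ j) (ρ (conjB3 i j)) := by
  rw [isConj_iff]
  exact ⟨ρ i, by rw [hρ.conj, inv_eq_of_mul_eq_one_right (hρ.mul_self i)]⟩

/-- For `z` in the list choose `g z` conjugating `y` to `z`. A product of `g z` with an element of
the centralizer still conjugates `y` to `z`, so it determines both factors. -/
theorem length_mul_card_centralizer_le [Finite G] (y : G) (l : List G) (hl : ∀ z ∈ l, IsConj y z)
    (hnd : l.Nodup) : l.length * Nat.card (Subgroup.centralizer {y}) ≤ Nat.card G := by
  choose! g hg using fun z hz => isConj_iff.1 (hl z hz)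
  let f : Fin l.length × Subgroup.centralizer {y} → G := fun p => g (l.get p.1) * p.2
  have hconj : ∀ p, f p * y * (f p)⁻¹ = l.get p.1 := by
    rintro ⟨i, c, hc⟩
    rw [Subgroup.mem_centralizer_singleton_iff] at hc
    rw [← hg _ (l.get_mem i)]
    change g (l.get i) * c * y * (g (l.get i) * c)⁻¹ = _
    rw [mul_assoc _ c, hc]
    group
  have hf : Function.Injective f := by
    rintro ⟨i, c⟩ ⟨j, d⟩ h
    have h1 := hconj (i, c)
    rw [h, hconj (j, d)] at h1
    have h2 : j = i := List.nodup_iff_injective_get.1 hnd h1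
    subst h2
    exact Prod.ext rfl (Subtype.ext (mul_left_cancel h))
  have := Nat.card_le_card_of_injective f hf
  simpa using this

theorem two_mul_card_le_of_lt [Finite G] {A B : Subgroup G} (hlt : A < B) :
    2 * Nat.card A ≤ Nat.card B := by
  obtain ⟨k, hk⟩ := Subgroup.card_dvd_of_le hlt.le
  have h0 : k ≠ 0 := by rintro rfl; simp [Nat.card_pos.ne'] at hk
  have h1 : k ≠ 1 := by
    rintro rfl
    exact hlt.ne (Subgroup.eq_of_le_of_card_ge hlt.le (by omega))
  rw [hk, mul_comm]
  exact Nat.mul_le_mul_left _ (by omega)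

end Frame

/-! ### Centralizers of the two involutions -/

theorem IsInternalDirectProduct.commute {G : Type*} [Group G] {x : G} {J : Subgroup G}
    (h : IsInternalDirectProduct (Subgroup.centralizer {x}) (Subgroup.zpowers x) J) {g : G}
    (hg : g ∈ J) : Commute x g :=
  h.1 x (Subgroup.mem_zpowers x) g hg

theorem IsInternalDirectProduct.notMem {G : Type*} [Group G] {x : G} {J : Subgroup G}
    (h : IsInternalDirectProduct (Subgroup.centralizer {x}) (Subgroup.zpowers x) J)
    (hx : orderOf x = 2) : x ∉ J := by
  intro hJ
  have : x ∈ Subgroup.zpowers x ⊓ J := ⟨Subgroup.mem_zpowers x, hJ⟩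
  rw [h.2.1, Subgroup.mem_bot] at this
  simp [this] at hx

/-- The involution `x` centralizes itself but lies outside `J`. -/
theorem IsInternalDirectProduct.lt {G : Type*} [Group G] {x : G} {J : Subgroup G}
    (h : IsInternalDirectProduct (Subgroup.centralizer {x}) (Subgroup.zpowers x) J)
    (hx : orderOf x = 2) : J < Subgroup.centralizer {x} := by
  refine lt_of_le_of_ne (h.2.2 ▸ le_sup_right) fun heq => h.notMem hx ?_
  rw [heq, Subgroup.mem_centralizer_singleton_iff]

end WeylRecognition

end

/-! ### The recognition theorem -/

open WeylRecognition in
theorem mainTheorem6 {G : Type*} [Group G] (x y : G)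
    (hx : orderOf x = 2) (hy : orderOf y = 2) (hxy : ¬ IsConj x y)
    (J K : Subgroup G)
    (hJ : WeylRecognition.IsInternalDirectProduct
      (Subgroup.centralizer {x}) (Subgroup.zpowers x) J)
    (hK : WeylRecognition.IsInternalDirectProduct
      (Subgroup.centralizer {y}) (Subgroup.zpowers y) K)
    (φ : J ≃* WeylRecognition.weylGroup (WeylRecognition.rootsB 3))
    (ψ : K ≃* WeylRecognition.weylGroup (WeylRecognition.rootsC 3))
    (hxK : WeylRecognition.IsShortRootReflectionIn ψ x)
    (hyJ : WeylRecognition.IsLongRootReflectionIn φ y)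
    (h₁ : ∃ x₁ ∈ J ⊓ K, ∃ y₁ ∈ J ⊓ K, orderOf x₁ = 2 ∧ orderOf y₁ = 2 ∧
      WeylRecognition.IsShortRootReflectionIn ψ x₁ ∧
      WeylRecognition.IsShortRootReflectionIn φ x₁ ∧
      WeylRecognition.IsLongRootReflectionIn ψ y₁ ∧
      WeylRecognition.IsLongRootReflectionIn φ y₁ ∧
      ∃ y₀ x₀ : G, WeylRecognition.IsLongRootReflectionIn φ y₀ ∧ y₀ ≠ y ∧ y₀ ≠ y₁ ∧
        WeylRecognition.IsShortRootReflectionIn ψ x₀ ∧ x₀ ≠ x ∧ x₀ ≠ x₁ ∧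
        Commute x₀ y₀)
    (hgen : J ⊔ K = ⊤) :
    Nonempty (G ≃* WeylRecognition.weylGroup WeylRecognition.rootsF4) := by
  obtain ⟨ρ, hρ, hρ'⟩ := exists_isReflectionFrame weylGroup_rootsB3 φ
  obtain ⟨σ, hσ, hσ'⟩ := exists_isReflectionFrame weylGroup_rootsC3 ψ
  have longJ : ∀ {g}, IsLongRootReflectionIn φ g → ∃ k < 6, g = ρ k := by
    rintro g ⟨hg, α, hα, h⟩
    obtain ⟨k, hk, hr⟩ := hα.exists_reflB3
    exact ⟨k, hk, hρ' g hg k (h.trans hr)⟩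
  have shortJ : ∀ {g}, IsShortRootReflectionIn φ g → ∃ k, 6 ≤ k ∧ g = ρ k := by
    rintro g ⟨hg, α, hα, h⟩
    obtain ⟨k, hk, hr⟩ := hα.exists_reflB3
    exact ⟨k, hk, hρ' g hg k (h.trans hr)⟩
  have longK : ∀ {g}, IsLongRootReflectionIn ψ g → ∃ k, 6 ≤ k ∧ g = σ k := by
    rintro g ⟨hg, α, hα, h⟩
    obtain ⟨k, hk, hr⟩ := hα.exists_reflC3
    exact ⟨k, hk, hσ' g hg k (h.trans hr)⟩
  have shortK : ∀ {g}, IsShortRootReflectionIn ψ g → ∃ k < 6, g = σ k := by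
    rintro g ⟨hg, α, hα, h⟩
    obtain ⟨k, hk, hr⟩ := hα.exists_reflC3
    exact ⟨k, hk, hσ' g hg k (h.trans hr)⟩
  obtain ⟨x₁, ⟨hx₁J, hx₁K⟩, y₁, ⟨hy₁J, hy₁K⟩, -, -, x₁short, x₁short', y₁long, y₁long', y₀, x₀,
    y₀long, hy₀, hy₀', x₀short, hx₀, hx₀', hcomm⟩ := h₁
  obtain ⟨t, ht, hyt⟩ := longJ hyJ
  obtain ⟨t', ht', hyt'⟩ := longJ y₁long'
  obtain ⟨t₀, ht₀, hyt₀⟩ := longJ y₀long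
  obtain ⟨s, hs, hxs⟩ := shortJ x₁short'
  obtain ⟨u, hu, hxu⟩ := shortK hxK
  obtain ⟨u', hu', hxu'⟩ := shortK x₁short
  obtain ⟨u₀, hu₀, hxu₀⟩ := shortK x₀short
  obtain ⟨v, hv, hyv⟩ := longK y₁long
  -- Elements of `J ⊓ K` commute with `y` and differ from it, as `y` is not in `K`; this forces the
  -- standard position.
  have posJ : InPosition t t' t₀ s := by
    refine ⟨ht, ht', ht₀, hs, ?_, ?_, ?_, ?_, ?_⟩
    · rintro rfl
      exact hK.notMem hy (hyt.trans hyt'.symm ▸ hy₁K)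
    · rintro rfl
      exact hy₀ (hyt₀.trans hyt.symm)
    · rintro rfl
      exact hy₀' (hyt₀.trans hyt'.symm)
    · rw [← hρ.commute_iff, ← hyt, ← hyt']
      exact hK.commute hy₁K
    · rw [← hρ.commute_iff, ← hyt, ← hxs]
      exact (hK.commute hx₁K).symm
  have posK : InPosition u u' u₀ v := by
    refine ⟨hu, hu', hu₀, hv, ?_, ?_, ?_, ?_, ?_⟩
    · rintro rfl
      exact hJ.notMem hx (hxu.trans hxu'.symm ▸ hx₁J)
    · rintro rfl
      exact hx₀ (hxu₀.trans hxu.symm)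
    · rintro rfl
      exact hx₀' (hxu₀.trans hxu'.symm)
    · rw [← hσ.commute_iff, ← hxu, ← hxu']
      exact hJ.commute hx₁J
    · rw [← hσ.commute_iff, ← hxu, ← hyv]
      exact (hJ.commute hy₁J).symm
  have hrel : F4Relations x x₀ y₁ y₀ := by
    refine ⟨hxu ▸ hσ.mul_self u, hxu₀ ▸ hσ.mul_self u₀, hyv ▸ hσ.mul_self v,
      hyt₀ ▸ hρ.mul_self t₀, ?_, ?_, ?_, hJ.commute hy₁J, hJ.commute (hyt₀ ▸ hρ.mem t₀), hcomm⟩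
    · rw [hxu, hxu₀, ← hσ.conj, ← hσ.conj, posK.braid]
    -- The reflections `y₁` and `x₀ * y₁ * x₀` commute, being in orthogonal coordinate axes of `C₃`.
    · have h := hσ.commute_iff.2 posK.conj_conj
      rw [hσ.conj, ← hyv, ← hxu₀] at h
      simpa only [mul_assoc] using h.symm.eq
    · rw [hyt', hyt₀, ← hρ.conj, ← hρ.conj, posJ.symm.braid]
  have hgen' : Subgroup.closure {x, x₀, y₁, y₀} = ⊤ := by
    have hKle : K ≤ Subgroup.closure {x, x₀, y₁, y₀} := by
      rw [← posK.closure_eq hσ, ← hxu, ← hxu₀, ← hyv]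
      apply Subgroup.closure_mono
      rintro _ (rfl | rfl | rfl) <;> simp
    have hJle : J ≤ Subgroup.closure {x, x₀, y₁, y₀} := by
      -- Exchanging `y` and `y₁` lets `y₁` serve as a generator of `J` in place of `y`.
      rw [← posJ.symm.closure_eq hρ, ← hyt', ← hyt₀, ← hxs, Subgroup.closure_le]
      rintro _ (rfl | rfl | rfl)
      exacts [Subgroup.subset_closure (by simp), Subgroup.subset_closure (by simp), hKle hx₁K]
    exact top_le_iff.1 (hgen ▸ sup_le hJle hKle)
  have hfinG : Finite G := by
    have := hrel.card_closure_le.1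
    rw [hgen'] at this
    exact Finite.of_equiv _ Subgroup.topEquiv.toEquiv
  have hcard : 576 < Nat.card G := by
    have hfinK : Finite (Subgroup.closure (Set.range reflB3)) :=
      weylGroup_rootsC3 ▸ Finite.of_equiv _ ψ.toEquiv
    have hKcard : 48 ≤ Nat.card K := by
      rw [Nat.card_congr ψ.toEquiv, weylGroup_rootsC3]
      exact card_closure_reflB3
    have hcent := two_mul_card_le_of_lt (hK.lt hy)
    have hz : x₀ * y₁ * x₀ = σ (conjB3 u₀ v) := by rw [hσ.conj, ← hxu₀, ← hyv]
    -- Since `x` centralizes `J`, this places the seventh conjugate of `y` outside `J`.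
    have hnc : ¬ Commute x (x₀ * y₁ * x₀) := by
      rw [hz, hxu, hσ.commute_iff]
      exact posK.conj_conj_ne
    have hconj : IsConj y y₁ := by
      rw [hyt, hyt', ← posJ.conj_eq]
      exact ((hρ.isConj _ _).trans (hρ.isConj _ _)).trans (hρ.isConj _ _)
    have := length_mul_card_centralizer_le y ((x₀ * y₁ * x₀) ::
      [t, conjB3 t₀ t, conjB3 t (conjB3 t₀ t), conjB3 s (conjB3 t₀ t),
        conjB3 s (conjB3 t (conjB3 t₀ t)), conjB3 t₀ (conjB3 s (conjB3 t₀ t))].map ρ) (by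
      simp only [List.map_cons, List.map_nil, List.forall_mem_cons, List.not_mem_nil,
        false_imp_iff, implies_true, and_true]
      have h1 := hρ.isConj t₀ t
      rw [← hyt] at h1
      refine ⟨hconj.trans ?_, hyt ▸ IsConj.refl _, h1, h1.trans (hρ.isConj _ _),
        h1.trans (hρ.isConj _ _), (h1.trans (hρ.isConj _ _)).trans (hρ.isConj _ _),
        (h1.trans (hρ.isConj _ _)).trans (hρ.isConj _ _)⟩
      rw [hz, hyv]
      exact hσ.isConj _ _) (by
      refine List.nodup_cons.2 ⟨fun h => hnc ?_, posJ.nodup.map hρ.injective⟩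
      obtain ⟨k, -, hk⟩ := List.mem_map.1 h
      rw [← hk]
      exact hJ.commute (hρ.mem k))
    simp only [List.length_cons, List.length_map, List.length_nil] at this
    omega
  -- Finiteness comes from the Coxeter relations; without it `Nat.card` could be the default value
  -- 0.
  have hfinW : Finite (weylGroup rootsF4) :=
    closure_reflF4 ▸ f4Relations_reflF4.card_closure_le.1
  have hcardW := card_weylGroup_rootsF4
  let r : ∀ k : Fin 24, k < 4 → weylGroup rootsF4 := fun k hk => ⟨reflF4 k, reflF4_simple_mem hk⟩
  have hrelW : F4Relations (r 0 (by decide)) (r 1 (by decide)) (r 2 (by decide))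
      (r 3 (by decide)) := f4Relations_reflF4.subtype
  refine hrel.nonempty_mulEquiv hrelW hgen' ?_ hcard (by omega)
  -- Generation is checked in the ambient isometry group.
  apply Subgroup.map_injective (weylGroup rootsF4).subtype_injective
  rw [MonoidHom.map_closure, ← MonoidHom.range_eq_map, Subgroup.range_subtype]
  refine Eq.trans ?_ closure_reflF4
  simp [Set.image_insert_eq, r]
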